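/- Let $\mathbb{D}=\{z\in\mathbb{C}:|z|<1\}$. Let $\mathcal{B}$ be the class of functions $f$ analytic on $\mathbb{D}\setminus\{0\}$ of the form $f(z)=\frac1z+a_0+a_1z+a_2z^2+\cdots$. A function $f\in\mathcal{B}$ is called locally univalent if $f'(z)\neq 0$ for all $z\in\mathbb{D}\setminus\{0\}$, and its Schwarzian derivative is $$S_f=\left(\frac{f''}{f'}\right)'-\frac12\left(\frac{f''}{f'}\right)^2 .$$ For $\alpha\in[0,1)$ let $\mathcal{BC}(\alpha)$ (the meromorphically convex functions of order $\alpha$) be the class of $f\in\mathcal{B}$ with $f'(z)\ne0$ and $$\operatorname{Re}\left(1+\frac{zf''(z)}{f'(z)}\right)\le-\alpha\qquad\text{for all } z\in\mathbb{D}\setminus\{0\}.$$ For $\beta\ge0$ let $\mathcal{P}(\beta)$ be the class of continuous functions $q:[0,1)\to[0,\infty)$ such that the solution $y$ on $[0,1)$ of $y''+qy=0$, $y(0)=0$, $y'(0)=1$ is positive on $(0,1)$ and the limit $\lim_{x\to1^-}y'(x)/y(x)$ exists and is at least $\beta$. **Theorem.** Let $\alpha\in[0,1)$. (i) If $q\in\mathcal{P}\left(\frac{1+\alpha}{2}\right)$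 and $f\in\mathcal{B}$ is locally univalent with $|S_f(z)|\le 2q(|z|)$ for all $z\in\mathbb{D}\setminus\{0\}$, then $f\in\mathcal{BC}(\alpha)$. (ii) The constant $\frac{1+\alpha}{2}$ is best possible: for every $\beta$ with $0\le\beta<\frac{1+\alpha}{2}$ there exist $q\in\mathcal{P}(\beta)$ and a locally univalent $f\in\mathcal{B}$ with $|S_f(z)|\le 2q(|z|)$ for all $z\in\mathbb{D}\setminus\{0\}$ such that $f\notin\mathcal{BC}(\alpha)$. -/

import Mathlib

open Set Filter Topology

noncomputable section

/-- The punctured open unit disk `{z : 0 < |z| < 1}`. -/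
def puncturedDisk : Set ℂ := {z : ℂ | z ≠ 0 ∧ ‖z‖ < 1}

/-- The class `𝓑`: functions of the form `f z = 1 / z + a₀ + a₁ z + a₂ z ^ 2 + ⋯` on the punctured
unit disk, that is, `1 / z` plus a function holomorphic on the whole unit disk.  The value of `f`
at the pole `0` is irrelevant. -/
def ClassB : Set (ℂ → ℂ) :=
  {f | ∃ h : ℂ → ℂ, DifferentiableOn ℂ h (Metric.ball 0 1) ∧
    ∀ z ∈ puncturedDisk, f z = 1 / z + h z}

/-- Local univalence of a function of the class `𝓑`: the derivative has no zero in the punctured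
disk (at the simple pole `0` local univalence is automatic). -/
def IsLocallyUnivalent (f : ℂ → ℂ) : Prop :=
  ∀ z ∈ puncturedDisk, deriv f z ≠ 0

/-- The Schwarzian derivative `(f'' / f')' - (1 / 2) (f'' / f') ^ 2`. -/
def schwarzian (f : ℂ → ℂ) (z : ℂ) : ℂ :=
  deriv (fun w => deriv (deriv f) w / deriv f w) z
    - (1 / 2) * (deriv (deriv f) z / deriv f z) ^ 2

/-- The class `𝓑𝓒(α)` of meromorphically convex functions of order `α`. -/
def ClassBC (α : ℝ) : Set (ℂ → ℂ) :=
  {f | f ∈ ClassB ∧ (∀ z ∈ puncturedDisk, deriv f z ≠ 0) ∧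
    ∀ z ∈ puncturedDisk, (1 + z * deriv (deriv f) z / deriv f z).re ≤ -α}

/-- `y`, with derivative `dy`, is the solution on `[0, 1)` of `y'' + q y = 0`, `y 0 = 0`,
`y' 0 = 1` (derivatives at `0` are one-sided). -/
structure IsInitialSolution (q y dy : ℝ → ℝ) : Prop where
  hasDeriv : ∀ x ∈ Ico (0 : ℝ) 1, HasDerivWithinAt y (dy x) (Ico 0 1) x
  hasDeriv₂ : ∀ x ∈ Ico (0 : ℝ) 1, HasDerivWithinAt dy (-(q x * y x)) (Ico 0 1) x
  init : y 0 = 0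
  init_deriv : dy 0 = 1

/-- The class `𝓟(β)`: continuous nonnegative functions `q` on `[0, 1)` such that the solution of
`y'' + q y = 0`, `y 0 = 0`, `y' 0 = 1` is positive on `(0, 1)` and `lim_{x → 1⁻} y' x / y x`
exists and is at least `β`. -/
def ClassP (β : ℝ) : Set (ℝ → ℝ) :=
  {q | ContinuousOn q (Ico 0 1) ∧ (∀ r ∈ Ico (0 : ℝ) 1, 0 ≤ q r) ∧
    ∃ y dy : ℝ → ℝ, IsInitialSolution q y dy ∧ (∀ x ∈ Ioo (0 : ℝ) 1, 0 < y x) ∧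
      ∃ L : ℝ, Tendsto (fun x => dy x / y x) (𝓝[<] 1) (𝓝 L) ∧ β ≤ L}

end

/-!
For `f` in the class `𝓑`, the function `u = (-f') ^ (-1 / 2)`, normalized by `u ~ z` at `0`, solves
`u'' + (S_f / 2) u = 0`, and `1 + z f'' / f' = 1 - 2 z u' / u`.  Membership in `𝓑𝓒(α)` therefore
means `Re (z u' / u) ≥ (1 + α) / 2`.  No branch of the square root is needed: `f' = -g / z ^ 2` with
`g` holomorphic and zero free on the disk, and with `φ = g' / g` one has `z u' / u = 1 - z φ / 2`.

Along a ray, `m = |u|` satisfies `m'' ≥ -q m`, so a Sturm-type argument with the Wronskian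
`m' y - m y'` (`IsInitialSolution.mul_le_of_re_le`) gives `Re (z u' / u) ≥ r y' r / y r` on the
circle `|z| = r`.  Since `Re (z u' / u)` is harmonic on the whole disk, the minimum principle pushes
this bound inward from circles `r → 1`, where the right-hand side tends to
`L = lim y' / y ≥ (1 + α) / 2`.

Sharpness comes from constant `q = c ^ 2`.  Then `y x = sin (c x) / c` and `L = c cot c`, which takes
every value in `[0, 1)` for `c ∈ (0, π)`.  The function `f z = c cot (c z)` has `S_f = 2 c ^ 2`, and
`1 + z f'' / f' = 1 - 2 z c cot (c z)` tends to `1 - 2 L` as `z → 1`, so `f` lies outside `𝓑𝓒(α)`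
as soon as `L < (1 + α) / 2`.
-/

/-! ### The pre-Schwarzian and the comparison along rays -/

theorem isOpen_puncturedDisk : IsOpen puncturedDisk :=
  (isOpen_ne_fun continuous_id continuous_const).inter (isOpen_lt continuous_norm continuous_const)

theorem puncturedDisk_subset_ball {z : ℂ} (hz : z ∈ puncturedDisk) :
    z ∈ Metric.ball (0 : ℂ) 1 := mem_ball_zero_iff.2 hz.2

/-- A locally univalent `f` of the class `𝓑` has `f' = -g / z ^ 2` with `g` holomorphic and zero
free on the whole disk, so its pre-Schwarzian is `-2 / z` plus the holomorphic function
`φ = g' / g`. -/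
theorem exists_preSchwarzian_eq {f : ℂ → ℂ} (hf : f ∈ ClassB) (hu : IsLocallyUnivalent f) :
    ∃ φ : ℂ → ℂ, DifferentiableOn ℂ φ (Metric.ball 0 1) ∧
      ∀ z ∈ puncturedDisk, deriv (deriv f) z / deriv f z = φ z - 2 / z := by
  obtain ⟨h, hh, hfh⟩ := hf
  have hh' : DifferentiableOn ℂ (deriv h) (Metric.ball 0 1) := hh.deriv Metric.isOpen_ball
  set g : ℂ → ℂ := fun z => 1 - z ^ 2 * deriv h z with hg
  have hgd : DifferentiableOn ℂ g (Metric.ball 0 1) := by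
    rw [hg]; fun_prop
  have hf1 : ∀ z ∈ puncturedDisk, deriv f z = -g z / z ^ 2 := by
    intro z hz
    have hz0 : z ≠ 0 := hz.1
    have he : f =ᶠ[𝓝 z] fun w => w⁻¹ + h w := by
      filter_upwards [isOpen_puncturedDisk.mem_nhds hz] with w hw
      rw [hfh w hw, one_div]
    have hd : HasDerivAt h (deriv h z) z :=
      ((hh z (puncturedDisk_subset_ball hz)).differentiableAt
        (Metric.isOpen_ball.mem_nhds (puncturedDisk_subset_ball hz))).hasDerivAt
    have hd1 : HasDerivAt (fun w => w⁻¹ + h w) _ z := (hasDerivAt_inv hz0).add hd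
    rw [he.deriv_eq, hd1.deriv, hg]
    field_simp
    ring
  have hg0 : ∀ z ∈ Metric.ball (0 : ℂ) 1, g z ≠ 0 := by
    intro z hz
    by_cases hz0 : z = 0
    · simp [hg, hz0]
    · have hzU : z ∈ puncturedDisk := ⟨hz0, mem_ball_zero_iff.1 hz⟩
      intro h0
      exact hu z hzU (by rw [hf1 z hzU, h0]; simp)
  refine ⟨fun z => deriv g z / g z, (hgd.deriv Metric.isOpen_ball).div hgd hg0, ?_⟩
  intro z hz
  have hz0 : z ≠ 0 := hz.1
  have hgz := hg0 z (puncturedDisk_subset_ball hz)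
  have he : deriv f =ᶠ[𝓝 z] fun w => -g w / w ^ 2 := by
    filter_upwards [isOpen_puncturedDisk.mem_nhds hz] with w hw using hf1 w hw
  have hd : HasDerivAt g (deriv g z) z :=
    ((hgd z (puncturedDisk_subset_ball hz)).differentiableAt
      (Metric.isOpen_ball.mem_nhds (puncturedDisk_subset_ball hz))).hasDerivAt
  have hd2 : HasDerivAt (fun w => -g w / w ^ 2) _ z :=
    hd.neg.div (hasDerivAt_pow 2 z) (pow_ne_zero 2 hz0)
  rw [he.deriv_eq, hd2.deriv, hf1 z hz]
  simp only [Pi.neg_apply]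
  field_simp
  push_cast
  ring

theorem schwarzian_eq_of_preSchwarzian_eq {f φ : ℂ → ℂ}
    (hφ : DifferentiableOn ℂ φ (Metric.ball 0 1))
    (h : ∀ z ∈ puncturedDisk, deriv (deriv f) z / deriv f z = φ z - 2 / z)
    {z : ℂ} (hz : z ∈ puncturedDisk) :
    schwarzian f z = deriv φ z - φ z ^ 2 / 2 + 2 * φ z / z := by
  have hz0 : z ≠ 0 := hz.1
  have he : (fun w => deriv (deriv f) w / deriv f w) =ᶠ[𝓝 z] fun w => φ w - 2 * w⁻¹ := by
    filter_upwards [isOpen_puncturedDisk.mem_nhds hz] with w hw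
    rw [h w hw, div_eq_mul_inv]
  have hd : HasDerivAt φ (deriv φ z) z :=
    ((hφ z (puncturedDisk_subset_ball hz)).differentiableAt
      (Metric.isOpen_ball.mem_nhds (puncturedDisk_subset_ball hz))).hasDerivAt
  have hd1 : HasDerivAt (fun w => φ w - 2 * w⁻¹) _ z :=
    hd.sub ((hasDerivAt_inv hz0).const_mul 2)
  rw [schwarzian, he.deriv_eq, h z hz, hd1.deriv]
  field_simp
  ring

/-- Comparison along a ray.  With `m = r * exp (-Re K)`, the modulus of the solution of the complex
equation whose logarithmic derivative is `1 / r - κ`, the Wronskian `m' y - m y'` vanishes at `0`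
and is nondecreasing, so `y' / y ≤ m' / m`. -/
theorem IsInitialSolution.mul_le_of_re_le {q y dy : ℝ → ℝ} (hy : IsInitialSolution q y dy)
    (hpos : ∀ x ∈ Ioo (0 : ℝ) 1, 0 < y x) {K κ κ' : ℝ → ℂ}
    (hK : ∀ r ∈ Ico (0 : ℝ) 1, HasDerivAt K (κ r) r)
    (hκ : ∀ r ∈ Ico (0 : ℝ) 1, HasDerivAt κ (κ' r) r)
    (hq : ∀ r ∈ Ioo (0 : ℝ) 1, (κ' r - κ r ^ 2 + 2 * κ r / r).re ≤ q r)
    {r : ℝ} (hr : r ∈ Ioo (0 : ℝ) 1) :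
    r * dy r ≤ (1 - r * (κ r).re) * y r := by
  have hre : ∀ {F : ℝ → ℂ} {F' : ℂ} {x : ℝ}, HasDerivAt F F' x →
      HasDerivAt (fun t => (F t).re) F'.re x := fun h =>
    Complex.reCLM.hasFDerivAt.comp_hasDerivAt _ h
  set E : ℝ → ℝ := fun t => Real.exp (-(K t).re)
  have hE : ∀ t ∈ Ico (0 : ℝ) 1, HasDerivAt E (E t * -(κ t).re) t := fun t ht =>
    (hre (hK t ht)).neg.exp
  set D : ℝ → ℝ := fun t => E t * ((1 - t * (κ t).re) * y t - t * dy t) with hD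
  have hcont : ContinuousOn D (Ico 0 1) := by
    have h1 : ContinuousOn E (Ico 0 1) := fun t ht => (hE t ht).continuousAt.continuousWithinAt
    have h2 : ContinuousOn (fun t => (κ t).re) (Ico 0 1) := fun t ht =>
      (hre (hκ t ht)).continuousAt.continuousWithinAt
    have h3 : ContinuousOn y (Ico 0 1) := fun t ht => (hy.hasDeriv t ht).continuousWithinAt
    have h4 : ContinuousOn dy (Ico 0 1) := fun t ht => (hy.hasDeriv₂ t ht).continuousWithinAt
    rw [hD]
    fun_prop
  have hderiv : ∀ t ∈ Ioo (0 : ℝ) 1, HasDerivAt D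
      (E t * y t * (t * (q t - (κ' t).re + (κ t).re ^ 2) - 2 * (κ t).re)) t := by
    intro t ht
    have ht' : t ∈ Ico (0 : ℝ) 1 := Ioo_subset_Ico_self ht
    have hn : Ico (0 : ℝ) 1 ∈ 𝓝 t := Ico_mem_nhds ht.1 ht.2
    have h3 := (hy.hasDeriv t ht').hasDerivAt hn
    have h4 := (hy.hasDeriv₂ t ht').hasDerivAt hn
    have h := (hE t ht').mul (((((hasDerivAt_id t).mul (hre (hκ t ht'))).const_sub 1).mul h3).sub
      ((hasDerivAt_id t).mul h4))
    refine h.congr_deriv ?_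
    simp only [id, Pi.mul_apply, Pi.sub_apply]
    ring
  have hmono : MonotoneOn D (Ico 0 1) := by
    refine monotoneOn_of_deriv_nonneg (convex_Ico 0 1) hcont ?_ ?_ <;> rw [interior_Ico]
    · exact fun t ht => (hderiv t ht).differentiableAt.differentiableWithinAt
    · intro t ht
      rw [(hderiv t ht).deriv]
      refine mul_nonneg (mul_nonneg (Real.exp_pos _).le (hpos t ht).le) ?_
      have h1 := hq t ht
      have h2 : (2 * κ t / t).re = 2 * (κ t).re / t := by
        rw [Complex.div_ofReal_re]; simp
      rw [Complex.add_re, Complex.sub_re, h2, pow_two, Complex.mul_re] at h1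
      have h3 : t * (2 * (κ t).re / t) = 2 * (κ t).re := by
        field_simp [ht.1.ne']
      -- The slack in the inequality is `t * (κ t).im ^ 2`.
      nlinarith [mul_le_mul_of_nonneg_left h1 ht.1.le, mul_nonneg ht.1.le (sq_nonneg (κ t).im)]
  have h0 : D 0 ≤ D r := hmono ⟨le_rfl, one_pos⟩ (Ioo_subset_Ico_self hr) hr.1.le
  have hD0 : D 0 = 0 := by simp [hD, hy.init]
  rw [hD0] at h0
  have := nonneg_of_mul_nonneg_right h0 (Real.exp_pos _)
  linarith

/-- The comparison lemma applied on the ray through `z`, where `κ r = e * φ (r * e) / 2` with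
`e = z / ‖z‖`. -/
theorem norm_mul_div_le_re {q y dy : ℝ → ℝ} (hy : IsInitialSolution q y dy)
    (hpos : ∀ x ∈ Ioo (0 : ℝ) 1, 0 < y x) {φ : ℂ → ℂ}
    (hφ : DifferentiableOn ℂ φ (Metric.ball 0 1))
    (hS : ∀ z ∈ puncturedDisk, ‖deriv φ z - φ z ^ 2 / 2 + 2 * φ z / z‖ ≤ 2 * q ‖z‖)
    {z : ℂ} (hz : z ∈ puncturedDisk) :
    ‖z‖ * (dy ‖z‖ / y ‖z‖) ≤ (1 - z * φ z / 2).re := by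
  obtain ⟨Φ, hΦ⟩ := hφ.isExactOn_ball
  have hn0 : ‖z‖ ≠ 0 := norm_ne_zero_iff.2 hz.1
  have hr : ‖z‖ ∈ Ioo (0 : ℝ) 1 := ⟨norm_pos_iff.2 hz.1, hz.2⟩
  obtain ⟨e, he, hze⟩ : ∃ e : ℂ, ‖e‖ = 1 ∧ (‖z‖ : ℂ) * e = z := by
    refine ⟨z / ‖z‖, by simp [hn0], ?_⟩
    have : (‖z‖ : ℂ) ≠ 0 := by exact_mod_cast hn0
    field_simp
  have hball : ∀ t ∈ Ico (0 : ℝ) 1, (t : ℂ) * e ∈ Metric.ball (0 : ℂ) 1 := by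
    intro t ht
    rw [mem_ball_zero_iff, norm_mul, he, mul_one, Complex.norm_real, Real.norm_of_nonneg ht.1]
    exact ht.2
  have hlin : ∀ t : ℝ, HasDerivAt (fun s : ℝ => (s : ℂ) * e) e t := by
    intro t
    simpa using (Complex.ofRealCLM.hasDerivAt (x := t)).mul_const e
  have hK : ∀ t ∈ Ico (0 : ℝ) 1, HasDerivAt (fun s : ℝ => Φ (s * e) / 2)
      (e * φ (t * e) / 2) t := by
    intro t ht
    have := ((hΦ _ (hball t ht)).comp t (hlin t)).div_const 2
    exact this.congr_deriv (by ring)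
  have hκ : ∀ t ∈ Ico (0 : ℝ) 1, HasDerivAt (fun s : ℝ => e * φ (s * e) / 2)
      (e ^ 2 * deriv φ (t * e) / 2) t := by
    intro t ht
    have hd : HasDerivAt φ (deriv φ (t * e)) (t * e) :=
      ((hφ _ (hball t ht)).differentiableAt
        (Metric.isOpen_ball.mem_nhds (hball t ht))).hasDerivAt
    have := ((hd.comp t (hlin t)).const_mul e).div_const 2
    exact this.congr_deriv (by ring)
  have he0 : e ≠ 0 := norm_ne_zero_iff.1 (by rw [he]; exact one_ne_zero)
  have key := hy.mul_le_of_re_le hpos hK hκ ?_ hr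
  · rw [← mul_div_assoc, div_le_iff₀ (hpos _ hr)]
    refine key.trans (le_of_eq ?_)
    have hzφ : (‖z‖ : ℂ) * (e * φ z / 2) = z * φ z / 2 := by
      linear_combination (φ z / 2) * hze
    rw [hze, ← Complex.re_ofReal_mul, hzφ, Complex.sub_re, Complex.one_re]
  · intro t ht
    have ht0 : (t : ℂ) ≠ 0 := by exact_mod_cast ht.1.ne'
    have hnorm : ‖(t : ℂ) * e‖ = t := by
      rw [norm_mul, he, mul_one, Complex.norm_real, Real.norm_of_nonneg ht.1.le]
    have h := hS (t * e) ⟨mul_ne_zero ht0 he0, by rw [hnorm]; exact ht.2⟩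
    rw [hnorm] at h
    have heq : e ^ 2 * deriv φ (t * e) / 2 - (e * φ (t * e) / 2) ^ 2 + 2 * (e * φ (t * e) / 2) / t
        = e ^ 2 / 2 * (deriv φ (t * e) - φ (t * e) ^ 2 / 2 + 2 * φ (t * e) / (t * e)) := by
      field_simp
    rw [heq]
    refine (Complex.re_le_norm _).trans ?_
    rw [norm_mul, norm_div, norm_pow, he, Complex.norm_ofNat]
    linarith

/-- The minimum principle for the real part of a holomorphic function on a disk. -/
theorem le_re_of_forall_norm_eq {F : ℂ → ℂ} (hF : DifferentiableOn ℂ F (Metric.ball 0 1))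
    {r m : ℝ} (hr : r ∈ Ioo (0 : ℝ) 1) (hm : ∀ z : ℂ, ‖z‖ = r → m ≤ (F z).re)
    {z : ℂ} (hz : ‖z‖ ≤ r) : m ≤ (F z).re := by
  have hsub : Metric.closedBall (0 : ℂ) r ⊆ Metric.ball 0 1 :=
    Metric.closedBall_subset_ball hr.2
  have hd : DiffContOnCl ℂ (fun w => Complex.exp (-F w)) (Metric.ball 0 r) := by
    refine DifferentiableOn.diffContOnCl ?_
    rw [closure_ball _ hr.1.ne']
    exact (hF.mono hsub).neg.cexp
  have h := Complex.norm_le_of_forall_mem_frontier_norm_le Metric.isBounded_ball hd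
    (C := Real.exp (-m)) ?_ (z := z) ?_
  · rw [Complex.norm_exp, Real.exp_le_exp, Complex.neg_re] at h
    linarith
  · intro w hw
    rw [frontier_ball _ hr.1.ne', mem_sphere_zero_iff_norm] at hw
    rw [Complex.norm_exp, Real.exp_le_exp, Complex.neg_re]
    linarith [hm w hw]
  · rwa [closure_ball _ hr.1.ne', mem_closedBall_zero_iff]

theorem mem_classBC_of_norm_schwarzian_le {α : ℝ} {q : ℝ → ℝ} (hq : q ∈ ClassP ((1 + α) / 2))
    {f : ℂ → ℂ} (hf : f ∈ ClassB) (hu : IsLocallyUnivalent f)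
    (hS : ∀ z ∈ puncturedDisk, ‖schwarzian f z‖ ≤ 2 * q ‖z‖) : f ∈ ClassBC α := by
  refine ⟨hf, hu, fun z hz => ?_⟩
  obtain ⟨-, -, y, dy, hy, hpos, L, hL, hβ⟩ := hq
  obtain ⟨φ, hφ, hP⟩ := exists_preSchwarzian_eq hf hu
  have hcmp : ∀ w ∈ puncturedDisk, ‖w‖ * (dy ‖w‖ / y ‖w‖) ≤ (1 - w * φ w / 2).re := fun w hw =>
    norm_mul_div_le_re hy hpos hφ
      (fun v hv => schwarzian_eq_of_preSchwarzian_eq hφ hP hv ▸ hS v hv) hw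
  have hF : DifferentiableOn ℂ (fun w => 1 - w * φ w / 2) (Metric.ball 0 1) := by fun_prop
  have hlim : Tendsto (fun r : ℝ => r * (dy r / y r)) (𝓝[<] 1) (𝓝 L) := by
    simpa using (tendsto_nhdsWithin_of_tendsto_nhds tendsto_id : Tendsto id (𝓝[<] (1 : ℝ)) _).mul hL
  -- `r * y' / y` need not be monotone, so the bound at `z` is read off from circles near the
  -- boundary rather than from the circle through `z`.
  have hLz : L ≤ (1 - z * φ z / 2).re := by
    refine le_of_tendsto hlim ?_
    filter_upwards [Ioo_mem_nhdsLT hz.2] with r hr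
    have hr0 : 0 < r := (norm_nonneg z).trans_lt hr.1
    refine le_re_of_forall_norm_eq hF ⟨hr0, hr.2⟩ (fun w hw => ?_) hr.1.le
    have h := hcmp w ⟨norm_ne_zero_iff.1 (by rw [hw]; exact hr0.ne'), by rw [hw]; exact hr.2⟩
    rwa [hw] at h
  have heq : 1 + z * deriv (deriv f) z / deriv f z
      = 1 - ((2 : ℝ) : ℂ) * (1 - z * φ z / 2) := by
    have hz0 : z ≠ 0 := hz.1
    rw [mul_div_assoc, hP z hz]
    push_cast
    field_simp
    ring
  rw [heq, Complex.sub_re, Complex.re_ofReal_mul, Complex.one_re]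
  linarith

/-! ### Sharpness -/

/-- Every `β` in `[0, 1)` is a value of `c * cot c`, by the intermediate value theorem on
`[√(1 - β), π / 2]`; at the left end `cos a ≥ 1 - a ^ 2 / 2` and `sin a ≤ a` give the sign. -/
theorem exists_mul_cos_eq_mul_sin {β : ℝ} (hβ0 : 0 ≤ β) (hβ1 : β < 1) :
    ∃ c : ℝ, 0 < c ∧ c < Real.pi ∧ c * Real.cos c = β * Real.sin c := by
  set a : ℝ := √(1 - β) with ha
  have ha0 : 0 < a := Real.sqrt_pos.2 (by linarith)
  have ha2 : a ^ 2 = 1 - β := Real.sq_sqrt (by linarith)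
  have ha1 : a ≤ 1 := by nlinarith
  have hpi := Real.pi_gt_three
  obtain ⟨c, hc, hc0⟩ : (0 : ℝ) ∈ (fun t : ℝ => t * Real.cos t - β * Real.sin t) ''
      Icc a (Real.pi / 2) := by
    refine intermediate_value_Icc' (by linarith) (by fun_prop) ⟨?_, ?_⟩
    · simpa using hβ0
    · have h1 := Real.one_sub_sq_div_two_le_cos (x := a)
      have h2 := Real.sin_lt ha0
      have h3 := mul_le_mul_of_nonneg_left h1 ha0.le
      have h4 := mul_le_mul_of_nonneg_left h2.le hβ0
      have h5 : a * (1 - a ^ 2 / 2) - β * a = a * ((1 - β) / 2) := by rw [ha2]; ring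
      have h6 : 0 ≤ a * ((1 - β) / 2) := mul_nonneg ha0.le (by linarith)
      linarith
  exact ⟨c, by linarith [hc.1], by linarith [hc.2], sub_eq_zero.1 hc0⟩

/-- For a constant `q = c ^ 2` the initial value problem is solved by `sin (c x) / c`, whose
logarithmic derivative at `1` is `c * cot c`. -/
theorem const_sq_mem_classP {β c : ℝ} (hc0 : 0 < c) (hc1 : c < Real.pi)
    (hcβ : c * Real.cos c = β * Real.sin c) : (fun _ => c ^ 2) ∈ ClassP β := by
  have hlin : ∀ x : ℝ, HasDerivAt (fun t : ℝ => c * t) c x := fun x => by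
    simpa using (hasDerivAt_id x).const_mul c
  have hsin : Real.sin c ≠ 0 := (Real.sin_pos_of_pos_of_lt_pi hc0 hc1).ne'
  refine ⟨continuousOn_const, fun _ _ => sq_nonneg c, fun x => Real.sin (c * x) / c,
    fun x => Real.cos (c * x), ⟨fun x _ => ?_, fun x _ => ?_, by simp, by simp⟩, ?_, β, ?_, le_rfl⟩
  · refine HasDerivAt.hasDerivWithinAt ?_
    exact ((hlin x).sin.div_const c).congr_deriv (by field_simp)
  · refine HasDerivAt.hasDerivWithinAt ?_
    exact (hlin x).cos.congr_deriv (by field_simp)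
  · intro x hx
    refine div_pos (Real.sin_pos_of_pos_of_lt_pi (mul_pos hc0 hx.1) ?_) hc0
    nlinarith [hx.2]
  · have hcont : ContinuousAt (fun x : ℝ => Real.cos (c * x) / (Real.sin (c * x) / c)) 1 := by
      refine ContinuousAt.div (by fun_prop) (by fun_prop) ?_
      simpa using ⟨hsin, hc0.ne'⟩
    have hval : Real.cos (c * 1) / (Real.sin (c * 1) / c) = β := by
      rw [mul_one]
      field_simp
      linarith
    have h : Tendsto _ (𝓝[<] (1 : ℝ)) _ := hcont.tendsto.mono_left nhdsWithin_le_nhds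
    rwa [hval] at h

/-- The function `c * cot (c z)`, whose Schwarzian derivative is constantly `2 * c ^ 2`. -/
noncomputable def scaledCot (c : ℝ) (z : ℂ) : ℂ := c * Complex.cos (c * z) / Complex.sin (c * z)

theorem sin_ofReal_mul_ne_zero {c : ℝ} (hc0 : 0 < c) (hc1 : c < Real.pi) {z : ℂ}
    (hz : z ∈ puncturedDisk) : Complex.sin (c * z) ≠ 0 := by
  intro h
  obtain ⟨k, hk⟩ := Complex.sin_eq_zero_iff.1 h
  have hk0 : k ≠ 0 := by
    rintro rfl
    have : (c : ℂ) ≠ 0 := by exact_mod_cast hc0.ne'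
    simp [this, hz.1] at hk
  have hn := congrArg norm hk
  have h1 : (1 : ℝ) ≤ |(k : ℝ)| := by exact_mod_cast Int.one_le_abs hk0
  rw [norm_mul, norm_mul, Complex.norm_real, Complex.norm_real, Complex.norm_intCast,
    Real.norm_of_nonneg hc0.le, Real.norm_of_nonneg Real.pi_pos.le] at hn
  nlinarith [hz.2, norm_nonneg z, Real.pi_pos]

theorem hasDerivAt_sin_ofReal_mul (c : ℝ) (z : ℂ) :
    HasDerivAt (fun w : ℂ => Complex.sin (c * w)) (c * Complex.cos (c * z)) z := by
  have h : HasDerivAt (fun w : ℂ => (c : ℂ) * w) c z := by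
    simpa using (hasDerivAt_id z).const_mul (c : ℂ)
  exact h.csin.congr_deriv (mul_comm _ _)

theorem hasDerivAt_cos_ofReal_mul (c : ℝ) (z : ℂ) :
    HasDerivAt (fun w : ℂ => Complex.cos (c * w)) (-(c * Complex.sin (c * z))) z := by
  have h : HasDerivAt (fun w : ℂ => (c : ℂ) * w) c z := by
    simpa using (hasDerivAt_id z).const_mul (c : ℂ)
  exact h.ccos.congr_deriv (by ring)

theorem scaledCot_mem_classB {c : ℝ} (hc0 : 0 < c) (hc1 : c < Real.pi) :
    scaledCot c ∈ ClassB := by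
  have hcC : (c : ℂ) ≠ 0 := by exact_mod_cast hc0.ne'
  -- Dividing `sin (c z)` by `z` leaves a zero-free function `s`, so `scaledCot c z = k z / z` with
  -- `k` holomorphic and `k 0 = 1`; the regular part is the difference quotient of `k` at `0`.
  set S : ℂ → ℂ := fun z => Complex.sin (c * z) with hS
  have hball : Metric.ball (0 : ℂ) 1 ∈ 𝓝 0 := Metric.ball_mem_nhds 0 one_pos
  have hSd : DifferentiableOn ℂ S (Metric.ball 0 1) := fun z _ =>
    (hasDerivAt_sin_ofReal_mul c z).differentiableAt.differentiableWithinAt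
  set s : ℂ → ℂ := dslope S 0 with hs
  have hsd : DifferentiableOn ℂ s (Metric.ball 0 1) :=
    (Complex.differentiableOn_dslope hball).2 hSd
  have hs0 : s 0 = c := by
    rw [hs, dslope_same, (hasDerivAt_sin_ofReal_mul c 0).deriv]; simp
  have hsz : ∀ z, z ≠ 0 → s z = Complex.sin (c * z) / z := by
    intro z hz
    rw [hs, dslope_of_ne _ hz, slope_def_field]
    simp [hS]
  set k : ℂ → ℂ := fun z => c * Complex.cos (c * z) / s z with hk
  have hkd : DifferentiableOn ℂ k (Metric.ball 0 1) := by
    refine DifferentiableOn.div (by fun_prop) hsd fun z hz => ?_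
    by_cases hz0 : z = 0
    · rw [hz0, hs0]; exact hcC
    · rw [hsz z hz0]
      exact div_ne_zero (sin_ofReal_mul_ne_zero hc0 hc1 ⟨hz0, mem_ball_zero_iff.1 hz⟩) hz0
  have hk0 : k 0 = 1 := by simp [hk, hs0, hcC]
  refine ⟨dslope k 0, (Complex.differentiableOn_dslope hball).2 hkd, fun z hz => ?_⟩
  have hz0 : z ≠ 0 := hz.1
  have hsin := sin_ofReal_mul_ne_zero hc0 hc1 hz
  rw [dslope_of_ne _ hz0, slope_def_field, hk0, hk, scaledCot]
  simp only [hsz z hz0]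
  field_simp
  ring

theorem deriv_scaledCot {c : ℝ} (hc0 : 0 < c) (hc1 : c < Real.pi) {z : ℂ}
    (hz : z ∈ puncturedDisk) :
    deriv (scaledCot c) z = -c ^ 2 / Complex.sin (c * z) ^ 2 := by
  have hsin := sin_ofReal_mul_ne_zero hc0 hc1 hz
  have h : HasDerivAt (scaledCot c) _ z :=
    ((hasDerivAt_cos_ofReal_mul c z).const_mul (c : ℂ)).div (hasDerivAt_sin_ofReal_mul c z) hsin
  rw [h.deriv]
  congr 1
  linear_combination (-(c : ℂ) ^ 2) * Complex.sin_sq_add_cos_sq (c * z)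

theorem preSchwarzian_scaledCot {c : ℝ} (hc0 : 0 < c) (hc1 : c < Real.pi) {z : ℂ}
    (hz : z ∈ puncturedDisk) :
    deriv (deriv (scaledCot c)) z / deriv (scaledCot c) z = -2 * scaledCot c z := by
  have hsin := sin_ofReal_mul_ne_zero hc0 hc1 hz
  have hcC : (c : ℂ) ≠ 0 := by exact_mod_cast hc0.ne'
  have he : deriv (scaledCot c) =ᶠ[𝓝 z] fun w => -c ^ 2 / Complex.sin (c * w) ^ 2 := by
    filter_upwards [isOpen_puncturedDisk.mem_nhds hz] with w hw using deriv_scaledCot hc0 hc1 hw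
  have h : HasDerivAt (fun w : ℂ => -(c : ℂ) ^ 2 / Complex.sin (c * w) ^ 2) _ z :=
    (hasDerivAt_const z (-(c : ℂ) ^ 2)).div ((hasDerivAt_sin_ofReal_mul c z).pow 2)
      (pow_ne_zero 2 hsin)
  rw [he.deriv_eq, h.deriv, deriv_scaledCot hc0 hc1 hz, scaledCot]
  field_simp
  push_cast
  ring

theorem schwarzian_scaledCot {c : ℝ} (hc0 : 0 < c) (hc1 : c < Real.pi) {z : ℂ}
    (hz : z ∈ puncturedDisk) : schwarzian (scaledCot c) z = 2 * c ^ 2 := by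
  have hsin := sin_ofReal_mul_ne_zero hc0 hc1 hz
  have he : (fun w => deriv (deriv (scaledCot c)) w / deriv (scaledCot c) w)
      =ᶠ[𝓝 z] fun w => -2 * scaledCot c w := by
    filter_upwards [isOpen_puncturedDisk.mem_nhds hz] with w hw
      using preSchwarzian_scaledCot hc0 hc1 hw
  rw [schwarzian, he.deriv_eq, preSchwarzian_scaledCot hc0 hc1 hz, deriv_const_mul_field,
    deriv_scaledCot hc0 hc1 hz, scaledCot]
  field_simp
  linear_combination (-(c : ℂ) ^ 2) * Complex.sin_sq_add_cos_sq (c * z)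

/-- On the positive radius `1 + z f'' / f'` equals `1 - 2 x c cot (c x)`, which tends to
`1 - 2 c cot c = 1 - 2 β > -α`. -/
theorem scaledCot_notMem_classBC {α β c : ℝ} (hc0 : 0 < c) (hc1 : c < Real.pi)
    (hcβ : c * Real.cos c = β * Real.sin c) (hβ : β < (1 + α) / 2) :
    scaledCot c ∉ ClassBC α := by
  rintro ⟨-, -, h⟩
  have hsin : Real.sin c ≠ 0 := (Real.sin_pos_of_pos_of_lt_pi hc0 hc1).ne'
  have hcont : ContinuousAt
      (fun x : ℝ => 1 - 2 * (x * (c * Real.cos (c * x) / Real.sin (c * x)))) 1 := by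
    refine continuousAt_const.sub (continuousAt_const.mul (continuousAt_id.mul ?_))
    exact ContinuousAt.div (by fun_prop) (by fun_prop) (by simpa using hsin)
  have hlim := hcont.tendsto.mono_left (nhdsWithin_le_nhds (s := Iio 1))
  rw [mul_one, hcβ, mul_div_assoc, div_self hsin] at hlim
  have hle := le_of_tendsto hlim (b := -α) ?_
  · linarith
  filter_upwards [Ioo_mem_nhdsLT (zero_lt_one (α := ℝ))] with x hx
  have hxU : (x : ℂ) ∈ puncturedDisk :=
    ⟨by exact_mod_cast hx.1.ne', by rw [Complex.norm_real, Real.norm_of_nonneg hx.1.le]; exact hx.2⟩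
  have h1 := h x hxU
  rw [mul_div_assoc, preSchwarzian_scaledCot hc0 hc1 hxU, scaledCot] at h1
  have heq : (1 + (x : ℂ) * (-2 * (c * Complex.cos (c * x) / Complex.sin (c * x))))
      = ((1 - 2 * (x * (c * Real.cos (c * x) / Real.sin (c * x))) : ℝ) : ℂ) := by
    push_cast
    ring
  rwa [heq, Complex.ofReal_re] at h1

theorem mainTheorem1 (α : ℝ) (hα : α ∈ Ico (0 : ℝ) 1) :
    (∀ q ∈ ClassP ((1 + α) / 2), ∀ f ∈ ClassB, IsLocallyUnivalent f →
      (∀ z ∈ puncturedDisk, ‖schwarzian f z‖ ≤ 2 * q ‖z‖) → f ∈ ClassBC α) ∧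
    (∀ β : ℝ, 0 ≤ β → β < (1 + α) / 2 →
      ∃ q ∈ ClassP β, ∃ f ∈ ClassB, IsLocallyUnivalent f ∧
        (∀ z ∈ puncturedDisk, ‖schwarzian f z‖ ≤ 2 * q ‖z‖) ∧ f ∉ ClassBC α) := by
  refine ⟨fun q hq f hf hu hS => mem_classBC_of_norm_schwarzian_le hq hf hu hS,
    fun β hβ0 hβ => ?_⟩
  obtain ⟨c, hc0, hc1, hcβ⟩ := exists_mul_cos_eq_mul_sin hβ0 (by linarith [hα.2])
  refine ⟨_, const_sq_mem_classP hc0 hc1 hcβ, scaledCot c, scaledCot_mem_classB hc0 hc1, ?_, ?_,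
    scaledCot_notMem_classBC hc0 hc1 hcβ hβ⟩
  · intro z hz
    rw [deriv_scaledCot hc0 hc1 hz]
    have hcC : (c : ℂ) ≠ 0 := by exact_mod_cast hc0.ne'
    exact div_ne_zero (neg_ne_zero.2 (pow_ne_zero 2 hcC))
      (pow_ne_zero 2 (sin_ofReal_mul_ne_zero hc0 hc1 hz))
  · intro z hz
    rw [schwarzian_scaledCot hc0 hc1 hz]
    simp
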